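/- Let $f:\mathbb R\to\mathbb R$ be a smooth function, let $\alpha,\beta,\gamma\in\mathbb R$ with $\alpha\neq 0$, and put $F(x,y,z)=f(x)+\alpha e^{2z}+\beta y+\gamma$ on $\mathbb R^3$ with coordinates $(x,y,z)$. Let $\xi=2\partial_z$, $\eta=\tfrac12(dz-y\,dx)$ and, with respect to the frame $(\partial_x,\partial_y,\partial_z)$, $$ g=\frac14\begin{pmatrix}F&1&-y\\1&0&0\\-y&0&1\end{pmatrix},\qquad \varphi=\begin{pmatrix}-1&0&0\\F-y^2&1&0\\-y&0&0\end{pmatrix} $$ (the columns of $\varphi$ are the images of $\partial_x,\partial_y,\partial_z$). Then $(\mathbb R^3,\varphi,\xi,\eta,g)$ is a paracontact Ricci soliton. That is: (1) $(\varphi,\xi,\eta,g)$ is a paracontact metric structure: $\varphi\xi=0$, $\eta\circ\varphi=0$, $\eta(\xi)=1$, $\varphi^2=\mathrm{Id}-\eta\otimes\xi$; the eigenspaces of $\varphi|_{\ker\eta}$ for the eigenvalues $1$ and $-1$ have equal dimension at every point; $g$ is a pseudo-Riemannian metric with $g(\varphi X,\varphi Y)=-g(X,Y)+\eta(X)\eta(Y)$;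 and $g(X,\varphi Y)=d\eta(X,Y)$, where $2\,d\eta(X,Y)=X(\eta(Y))-Y(\eta(X))-\eta([X,Y])$. (2) There is a real constant $\lambda$ with $\mathcal L_\xi g+\varrho=\lambda g$, where $\mathcal L_\xi$ is the Lie derivative and $\varrho$ is the Ricci tensor of $g$ (with the usual sign, positive on round spheres). Moreover, if $\beta\neq0$, then this paracontact metric structure is not locally homogeneous: it is not true that for all $p,q\in\mathbb R^3$ there is a smooth diffeomorphism $\psi$ from an open neighbourhood of $p$ onto an open neighbourhood of $q$ with $\psi(p)=q$, $\psi^*g=g$ and $\psi^*\eta=\eta$ (such a $\psi$ automatically preserves $\xi$ and $\varphi$ as well). -/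

import Mathlib

open scoped ContDiff Matrix

noncomputable section

/-! Tensor fields on the coordinate space `ℝᵐ`, written in the global coordinate frame
`∂₀, …, ∂ₘ₋₁`.  Only the smooth structure of `Fin m → ℝ` is used. -/

/-- The partial derivative `∂ᵢ u`. -/
def partialD {m : ℕ} (i : Fin m) (u : (Fin m → ℝ) → ℝ) (p : Fin m → ℝ) : ℝ :=
  fderiv ℝ u p (Pi.single i 1)

/-- A `(1,1)`-tensor field `φ`, a vector field `ξ`, a one-form `η` and a `(0,2)`-tensor field `g`
on `ℝᵐ`, given by their components: `φ(v) = φ *ᵥ v`, `η(v) = η ⬝ᵥ v`, `g(v,w) = v ⬝ᵥ (g *ᵥ w)`. -/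
structure TensorData (m : ℕ) where
  φ : (Fin m → ℝ) → Matrix (Fin m) (Fin m) ℝ
  ξ : (Fin m → ℝ) → (Fin m → ℝ)
  η : (Fin m → ℝ) → (Fin m → ℝ)
  g : (Fin m → ℝ) → Matrix (Fin m) (Fin m) ℝ

/-- `g` is a (smooth) pseudo-Riemannian metric on `ℝᵐ`. -/
def IsPseudoRiemannianMetric {m : ℕ} (g : (Fin m → ℝ) → Matrix (Fin m) (Fin m) ℝ) : Prop :=
  (∀ i j, ContDiff ℝ ∞ (fun p => g p i j)) ∧ (∀ p, (g p).IsSymm) ∧ (∀ p, IsUnit (g p).det)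

/-- Components of the exterior derivative of a one-form, with the convention
`2 dη(X,Y) = X(η(Y)) - Y(η(X)) - η([X,Y])`. -/
def dOneForm {m : ℕ} (η : (Fin m → ℝ) → (Fin m → ℝ)) (p : Fin m → ℝ) :
    Matrix (Fin m) (Fin m) ℝ :=
  fun i j => (1 / 2) * (partialD i (fun q => η q j) p - partialD j (fun q => η q i) p)

/-- Christoffel symbol `Γᵏᵢⱼ` of the Levi-Civita connection: `∇_{∂ᵢ} ∂ⱼ = ∑ₖ Γᵏᵢⱼ ∂ₖ`. -/
def christoffel {m : ℕ} (g : (Fin m → ℝ) → Matrix (Fin m) (Fin m) ℝ) (k i j : Fin m)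
    (p : Fin m → ℝ) : ℝ :=
  (1 / 2) * ∑ l, (g p)⁻¹ k l *
    (partialD i (fun q => g q j l) p + partialD j (fun q => g q i l) p
      - partialD l (fun q => g q i j) p)

/-- The `l`-th component of `R(∂ᵢ,∂ⱼ)∂ₖ`, where `R(X,Y) = ∇_[X,Y] - [∇_X,∇_Y]`. -/
def curvature {m : ℕ} (g : (Fin m → ℝ) → Matrix (Fin m) (Fin m) ℝ) (l i j k : Fin m)
    (p : Fin m → ℝ) : ℝ :=
  -(partialD i (christoffel g l j k) p - partialD j (christoffel g l i k) p
    + ∑ s, (christoffel g l i s p * christoffel g s j k p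
        - christoffel g l j s p * christoffel g s i k p))

/-- The Ricci tensor `ϱ(X,Y) = tr (V ↦ R(X,V)Y)`; for this sign convention of `R` it is the usual
Ricci tensor (positive on round spheres). -/
def ricci {m : ℕ} (g : (Fin m → ℝ) → Matrix (Fin m) (Fin m) ℝ) (p : Fin m → ℝ) :
    Matrix (Fin m) (Fin m) ℝ :=
  fun i j => ∑ k, curvature g k i k j p

/-- Components of the Lie derivative `𝓛_X g` of a `(0,2)`-tensor field. -/
def lieDerivMetric {m : ℕ} (X : (Fin m → ℝ) → (Fin m → ℝ))
    (g : (Fin m → ℝ) → Matrix (Fin m) (Fin m) ℝ) (p : Fin m → ℝ) :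
    Matrix (Fin m) (Fin m) ℝ :=
  fun i j => ∑ k, (X p k * partialD k (fun q => g q i j) p
    + g p k j * partialD i (fun q => X q k) p + g p i k * partialD j (fun q => X q k) p)

/-- The eigenspace, for the eigenvalue `c`, of the restriction of `φ` to `ker η` at `p`. -/
def horizontalEigenspace {m : ℕ} (S : TensorData m) (c : ℝ) (p : Fin m → ℝ) :
    Submodule ℝ (Fin m → ℝ) where
  carrier := {v | S.η p ⬝ᵥ v = 0 ∧ S.φ p *ᵥ v = c • v}
  zero_mem' := by simp
  add_mem' := by
    rintro v w ⟨hv, hv'⟩ ⟨hw, hw'⟩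
    exact ⟨by rw [dotProduct_add, hv, hw, add_zero],
      by rw [Matrix.mulVec_add, hv', hw', smul_add]⟩
  smul_mem' := by
    rintro r v ⟨hv, hv'⟩
    exact ⟨by rw [dotProduct_smul, hv, smul_zero],
      by rw [Matrix.mulVec_smul, hv', smul_comm]⟩

/-- `(φ,ξ,η)` is a (smooth) almost paracontact structure. -/
structure IsAlmostParacontact {m : ℕ} (S : TensorData m) : Prop where
  smooth_φ : ∀ i j, ContDiff ℝ ∞ (fun p => S.φ p i j)
  smooth_ξ : ContDiff ℝ ∞ S.ξ
  smooth_η : ContDiff ℝ ∞ S.η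
  φ_ξ : ∀ p, S.φ p *ᵥ S.ξ p = 0
  η_φ : ∀ p v, S.η p ⬝ᵥ (S.φ p *ᵥ v) = 0
  η_ξ : ∀ p, S.η p ⬝ᵥ S.ξ p = 1
  φ_sq : ∀ p v, S.φ p *ᵥ (S.φ p *ᵥ v) = v - (S.η p ⬝ᵥ v) • S.ξ p
  finrank_eq : ∀ p, Module.finrank ℝ (horizontalEigenspace S 1 p)
    = Module.finrank ℝ (horizontalEigenspace S (-1) p)

/-- `(φ,ξ,η,g)` is a paracontact metric structure: an almost paracontact structure with a
compatible pseudo-Riemannian metric, whose fundamental two-form `g(X,φY)` equals `dη(X,Y)`. -/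
structure IsParacontactMetric {m : ℕ} (S : TensorData m) : Prop where
  almost : IsAlmostParacontact S
  metric : IsPseudoRiemannianMetric S.g
  compatible : ∀ p v w, (S.φ p *ᵥ v) ⬝ᵥ (S.g p *ᵥ (S.φ p *ᵥ w))
    = -(v ⬝ᵥ (S.g p *ᵥ w)) + (S.η p ⬝ᵥ v) * (S.η p ⬝ᵥ w)
  fundamental : ∀ p v w, v ⬝ᵥ (S.g p *ᵥ (S.φ p *ᵥ w)) = v ⬝ᵥ (dOneForm S.η p *ᵥ w)

/-- A paracontact Ricci soliton: a paracontact metric manifold whose Reeb vector field `ξ`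
satisfies `𝓛_ξ g + ϱ = c g` for some real constant `c`. -/
def IsParacontactRicciSoliton {m : ℕ} (S : TensorData m) : Prop :=
  IsParacontactMetric S ∧
    ∃ c : ℝ, ∀ p, lieDerivMetric S.ξ S.g p + ricci S.g p = c • S.g p

/-- `ψ` is a smooth local diffeomorphism (between open sets) that is an isometry of `g` and leaves
`η` invariant.  For a paracontact metric structure such a `ψ` also preserves `ξ` and `φ`, because
`η = g(ξ,·)` and `g(·,φ·) = dη`. -/
structure IsLocalAutomorphism {m : ℕ} (S : TensorData m)
    (ψ : OpenPartialHomeomorph (Fin m → ℝ) (Fin m → ℝ)) : Prop where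
  smooth : ContDiffOn ℝ ∞ ψ ψ.source
  smooth_symm : ContDiffOn ℝ ∞ ψ.symm ψ.target
  isometry : ∀ p ∈ ψ.source, ∀ v w,
    (fderiv ℝ ψ p v) ⬝ᵥ (S.g (ψ p) *ᵥ fderiv ℝ ψ p w) = v ⬝ᵥ (S.g p *ᵥ w)
  map_η : ∀ p ∈ ψ.source, ∀ v, S.η (ψ p) ⬝ᵥ fderiv ℝ ψ p v = S.η p ⬝ᵥ v

/-- A paracontact metric structure is locally homogeneous if its pseudogroup of local
automorphisms acts transitively. -/
def IsLocallyHomogeneous {m : ℕ} (S : TensorData m) : Prop :=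
  ∀ p q : Fin m → ℝ, ∃ ψ : OpenPartialHomeomorph (Fin m → ℝ) (Fin m → ℝ),
    IsLocalAutomorphism S ψ ∧ p ∈ ψ.source ∧ ψ p = q

/-- `F(x,y,z) = f(x) + α e^{2z} + β y + γ`, with `(x,y,z) = (p 0, p 1, p 2)`. -/
def exampleF (f : ℝ → ℝ) (α β γ : ℝ) (p : Fin 3 → ℝ) : ℝ :=
  f (p 0) + α * Real.exp (2 * p 2) + β * p 1 + γ

/-- The structure on `ℝ³(x,y,z)` with `ξ = 2 ∂_z`, `η = ½ (dz - y dx)` and `g`, `φ` determined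
by `F`. -/
def exampleStructure (f : ℝ → ℝ) (α β γ : ℝ) : TensorData 3 where
  φ := fun p =>
    !![-1, 0, 0;
       exampleF f α β γ p - p 1 ^ 2, 1, 0;
       -p 1, 0, 0]
  ξ := fun _ => ![0, 0, 2]
  η := fun p => (1 / 2 : ℝ) • ![-p 1, 0, 1]
  g := fun p => (1 / 4 : ℝ) •
    !![exampleF f α β γ p, 1, -p 1;
       1, 0, 0;
       -p 1, 0, 1]

end

/-! ### Calculus of coordinate partial derivatives. -/

section PartialDerivatives

variable {m : ℕ} {u v : (Fin m → ℝ) → ℝ} {p : Fin m → ℝ}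

/-! The soliton equation is a direct computation: `ricci` equals -2g - α e^{2z} dx², and since ξ =
2∂_z acts on g only through F, 𝓛_ξ g = α e^{2z} dx² cancels the defect, so λ = -2
(`ricci_exampleStructure`, `lieDerivMetric_exampleStructure`).

For β ≠ 0, the coordinate y is invariant under every local automorphism (X, Y, Z)
(`snd_eq_of_preserves`), so points with different y are never related. Such a map preserves dz - y
dx and 4(g - η⊗η) = (F - y²)dx² + 2 dx dy. Algebra at each point gives X_y = X_z = Y_z = 0 and X_x
Y_y = 1 (`jacobian_entries_of_preserves`). Differentiating the dx² coefficient in z gives e^{2Z}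
X_x² = e^{2z}, by α ≠ 0; differentiating it in y gives X_x = 1, by β ≠ 0. Then Z_x = 0, and Z_x = Y
X_x - y yields Y = y. -/

theorem partialD_const (i : Fin m) (c : ℝ) : partialD i (fun _ => c) p = 0 := by
  simp [partialD]

theorem partialD_coord (i j : Fin m) :
    partialD i (fun q => q j) p = if i = j then 1 else 0 := by
  have h : HasFDerivAt (fun q : Fin m → ℝ => q j)
      (ContinuousLinearMap.proj (R := ℝ) (φ := fun _ => ℝ) j) p := hasFDerivAt_apply j p
  simp [partialD, h.fderiv, Pi.single_apply, eq_comm]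

theorem partialD_add (i : Fin m) (hu : DifferentiableAt ℝ u p) (hv : DifferentiableAt ℝ v p) :
    partialD i (fun q => u q + v q) p = partialD i u p + partialD i v p := by
  simp [partialD, fderiv_fun_add hu hv]

theorem partialD_sub (i : Fin m) (hu : DifferentiableAt ℝ u p) (hv : DifferentiableAt ℝ v p) :
    partialD i (fun q => u q - v q) p = partialD i u p - partialD i v p := by
  simp [partialD, fderiv_fun_sub hu hv]

theorem partialD_neg (i : Fin m) : partialD i (fun q => -u q) p = -partialD i u p := by
  simp [partialD, fderiv_fun_neg]

theorem partialD_mul (i : Fin m) (hu : DifferentiableAt ℝ u p) (hv : DifferentiableAt ℝ v p) :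
    partialD i (fun q => u q * v q) p = partialD i u p * v p + u p * partialD i v p := by
  simp [partialD, fderiv_fun_mul hu hv]
  ring

theorem partialD_pow_two (i : Fin m) (hu : DifferentiableAt ℝ u p) :
    partialD i (fun q => u q ^ 2) p = 2 * u p * partialD i u p := by
  simp_rw [pow_two]
  rw [partialD_mul i hu hu]
  ring

theorem partialD_comp (i : Fin m) {h : ℝ → ℝ} (hh : DifferentiableAt ℝ h (u p))
    (hu : DifferentiableAt ℝ u p) :
    partialD i (fun q => h (u q)) p = deriv h (u p) * partialD i u p := by
  have := (hh.hasDerivAt.comp_hasFDerivAt p hu.hasFDerivAt).fderiv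
  rw [Function.comp_def] at this
  simp [partialD, this]

theorem partialD_exp (i : Fin m) (hu : DifferentiableAt ℝ u p) :
    partialD i (fun q => Real.exp (u q)) p = Real.exp (u p) * partialD i u p := by
  rw [partialD_comp i Real.differentiableAt_exp hu, Real.deriv_exp]

theorem partialD_congr (i : Fin m) (h : u =ᶠ[nhds p] v) : partialD i u p = partialD i v p := by
  simp [partialD, h.fderiv_eq]

theorem ContDiffAt.partialD (i : Fin m) (hu : ContDiffAt ℝ ∞ u p) :
    ContDiffAt ℝ ∞ (partialD i u) p :=
  (hu.fderiv_right (m := ∞) (by simp)).clm_apply contDiffAt_const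

theorem partialD_comm (i j : Fin m) (hu : ContDiffAt ℝ ∞ u p) :
    partialD i (partialD j u) p = partialD j (partialD i u) p := by
  have hd : DifferentiableAt ℝ (fderiv ℝ u) p :=
    (hu.fderiv_right (m := ∞) (by simp)).differentiableAt (by simp)
  have key (i j : Fin m) : partialD i (partialD j u) p
      = fderiv ℝ (fderiv ℝ u) p (Pi.single i 1) (Pi.single j 1) := by
    have h := (hd.hasFDerivAt.clm_apply (hasFDerivAt_const (Pi.single j (1 : ℝ)) p)).fderiv
    change fderiv ℝ (fun q => fderiv ℝ u q (Pi.single j 1)) p _ = _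
    rw [h]
    simp
  rw [key, key]
  exact (hu.isSymmSndFDerivAt
    (by simpa using WithTop.coe_le_coe.2 (le_top (a := (2 : ℕ∞))))).eq _ _

end PartialDerivatives

/-! ### The paracontact metric structure and the soliton equation. -/

section RicciSoliton

variable {f : ℝ → ℝ} (α β γ : ℝ)

theorem differentiable_exampleF (hf : Differentiable ℝ f) :
    Differentiable ℝ (exampleF f α β γ) := by
  unfold exampleF
  fun_prop

theorem contDiff_exampleF (hf : ContDiff ℝ ∞ f) : ContDiff ℝ ∞ (exampleF f α β γ) := by
  unfold exampleF
  fun_prop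

theorem partialD_exampleF (hf : Differentiable ℝ f) (i : Fin 3) (p : Fin 3 → ℝ) :
    partialD i (exampleF f α β γ) p = ![deriv f (p 0), β, 2 * α * Real.exp (2 * p 2)] i := by
  unfold exampleF
  have h0 : partialD i (fun q : Fin 3 → ℝ => f (q 0)) p
      = deriv f (p 0) * partialD i (fun q => q 0) p :=
    partialD_comp i (u := fun q => q 0) hf.differentiableAt (by fun_prop)
  rw [partialD_add i (by fun_prop) (by fun_prop), partialD_add i (by fun_prop) (by fun_prop),
    partialD_add i (by fun_prop) (by fun_prop), partialD_mul i (by fun_prop) (by fun_prop),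
    partialD_mul i (by fun_prop) (by fun_prop), partialD_exp i (by fun_prop),
    partialD_mul i (by fun_prop) (by fun_prop), h0]
  simp only [partialD_const, partialD_coord]
  fin_cases i <;> simp
  ring

theorem exampleStructure_g_inv (f : ℝ → ℝ) (p : Fin 3 → ℝ) :
    ((exampleStructure f α β γ).g p)⁻¹ = (4 : ℝ) •
      !![0, 1, 0; 1, p 1 ^ 2 - exampleF f α β γ p, p 1; 0, p 1, 1] := by
  apply Matrix.inv_eq_right_inv
  ext i j
  fin_cases i <;> fin_cases j <;>
    simp [exampleStructure, Matrix.mul_apply, Fin.sum_univ_three] <;> ring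

theorem partialD_exampleStructure_g (hf : Differentiable ℝ f) (i j l : Fin 3) (p : Fin 3 → ℝ) :
    partialD i (fun q => (exampleStructure f α β γ).g q j l) p = (1 / 4) *
      (![!![deriv f (p 0), 0, 0; 0, 0, 0; 0, 0, 0], !![β, 0, -1; 0, 0, 0; -1, 0, 0],
        !![2 * α * Real.exp (2 * p 2), 0, 0; 0, 0, 0; 0, 0, 0]] i j l) := by
  have hF := differentiable_exampleF α β γ hf
  fin_cases j <;> fin_cases l <;>
    simp only [exampleStructure, Matrix.smul_apply, smul_eq_mul] <;>
    simp (disch := fun_prop) [partialD_mul, partialD_const, partialD_exampleF, partialD_neg,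
      partialD_coord] <;> fin_cases i <;> simp

/-- The Christoffel symbols of the example; the entry `k i j` is `Γᵏᵢⱼ`. -/
noncomputable def exampleChristoffel (f : ℝ → ℝ) (p : Fin 3 → ℝ) : Fin 3 → Matrix (Fin 3) (Fin 3) ℝ :=
  ![!![-β / 2, 0, 1 / 2; 0, 0, 0; 1 / 2, 0, 0],
    !![deriv f (p 0) / 2 - β * (p 1 ^ 2 - exampleF f α β γ p) / 2
          - p 1 * (α * Real.exp (2 * p 2)),
        β / 2 - p 1 / 2, α * Real.exp (2 * p 2) + (p 1 ^ 2 - exampleF f α β γ p) / 2;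
      β / 2 - p 1 / 2, 0, -1 / 2;
      α * Real.exp (2 * p 2) + (p 1 ^ 2 - exampleF f α β γ p) / 2, -1 / 2, 0],
    !![-(p 1 * β) / 2 - α * Real.exp (2 * p 2), -1 / 2, p 1 / 2; -1 / 2, 0, 0; p 1 / 2, 0, 0]]

theorem christoffel_exampleStructure (hf : Differentiable ℝ f) (k i j : Fin 3) :
    christoffel (exampleStructure f α β γ).g k i j
      = fun p => exampleChristoffel α β γ f p k i j := by
  funext p
  simp only [christoffel, exampleStructure_g_inv, partialD_exampleStructure_g α β γ hf,
    Fin.sum_univ_three, exampleChristoffel]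
  fin_cases k <;> fin_cases i <;> fin_cases j <;> simp <;> ring

theorem ricci_exampleStructure (hf : ContDiff ℝ ∞ f) (p : Fin 3 → ℝ) :
    ricci (exampleStructure f α β γ).g p = (-2 : ℝ) • (exampleStructure f α β γ).g p
      - !![α * Real.exp (2 * p 2), 0, 0; 0, 0, 0; 0, 0, 0] := by
  have hf1 : Differentiable ℝ f := hf.differentiable (by simp)
  have hf2 : Differentiable ℝ (deriv f) :=
    (contDiff_infty_iff_deriv.1 hf).2.differentiable (by simp)
  have hF := differentiable_exampleF α β γ hf1
  -- Γ¹₀₀ contains f′(x), so the curvature calls for the chain rule once more, now for f′.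
  have hc (i : Fin 3) : partialD i (fun q : Fin 3 → ℝ => deriv f (q 0)) p
      = deriv (deriv f) (p 0) * partialD i (fun q => q 0) p :=
    partialD_comp i (u := fun q => q 0) hf2.differentiableAt (by fun_prop)
  ext i j
  simp only [ricci, curvature, christoffel_exampleStructure α β γ hf1, Fin.sum_univ_three]
  fin_cases i <;> fin_cases j <;>
    simp [exampleChristoffel, exampleStructure] <;>
    simp (disch := fun_prop) [partialD_mul, partialD_const, partialD_exampleF, partialD_neg,
      partialD_coord, partialD_add, partialD_sub, partialD_pow_two, partialD_exp, hc,
      div_eq_mul_inv] <;> ring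

theorem lieDerivMetric_exampleStructure (hf : Differentiable ℝ f) (p : Fin 3 → ℝ) :
    lieDerivMetric (exampleStructure f α β γ).ξ (exampleStructure f α β γ).g p
      = !![α * Real.exp (2 * p 2), 0, 0; 0, 0, 0; 0, 0, 0] := by
  ext i j
  simp only [lieDerivMetric, partialD_exampleStructure_g α β γ hf, Fin.sum_univ_three]
  fin_cases i <;> fin_cases j <;> simp [exampleStructure, partialD_const] <;> ring

theorem horizontalEigenspace_one_exampleStructure (f : ℝ → ℝ) (p : Fin 3 → ℝ) :
    horizontalEigenspace (exampleStructure f α β γ) 1 p = ℝ ∙ ![0, 1, 0] := by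
  ext v
  rw [Submodule.mem_span_singleton]
  change (_ ∧ _) ↔ _
  simp only [exampleStructure, funext_iff, Fin.forall_fin_succ, dotProduct, Matrix.mulVec,
    Fin.sum_univ_three]
  simp
  constructor
  · rintro ⟨h, h0, h1, h2⟩
    have : v 0 = 0 := by linarith
    exact ⟨this.symm, by rw [← h2, this, mul_zero, neg_zero]⟩
  · rintro ⟨h0, h2⟩
    simp [← h0, ← h2]

/-- The kernel of η forces the third entry y; the second row of φ then fixes the middle entry. Both
eigenspaces are thus lines, which gives equal dimensions. -/
theorem horizontalEigenspace_neg_one_exampleStructure (f : ℝ → ℝ) (p : Fin 3 → ℝ) :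
    horizontalEigenspace (exampleStructure f α β γ) (-1) p
      = ℝ ∙ ![1, (p 1 ^ 2 - exampleF f α β γ p) / 2, p 1] := by
  ext v
  rw [Submodule.mem_span_singleton]
  change (_ ∧ _) ↔ _
  simp only [exampleStructure, funext_iff, Fin.forall_fin_succ, dotProduct, Matrix.mulVec,
    Fin.sum_univ_three]
  simp
  constructor
  · rintro ⟨h, h1, h2⟩
    exact ⟨by linarith, by linarith⟩
  · rintro ⟨h1, h2⟩
    exact ⟨by linarith, by linarith, by linarith⟩

theorem isAlmostParacontact_exampleStructure (hf : ContDiff ℝ ∞ f) :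
    IsAlmostParacontact (exampleStructure f α β γ) where
  smooth_φ i j := by
    have hF := contDiff_exampleF α β γ hf
    fin_cases i <;> fin_cases j <;> simp [exampleStructure] <;> fun_prop
  smooth_ξ := contDiff_const
  smooth_η := by
    refine contDiff_pi.2 fun i => ?_
    fin_cases i <;> simp [exampleStructure] <;> fun_prop
  φ_ξ p := by
    ext i
    fin_cases i <;> simp [exampleStructure, Matrix.mulVec, dotProduct, Fin.sum_univ_three]
  η_φ p v := by
    simp [exampleStructure, Matrix.mulVec, dotProduct, Fin.sum_univ_three]
    ring
  η_ξ p := by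
    simp [exampleStructure, dotProduct, Fin.sum_univ_three]
  φ_sq p v := by
    ext i
    fin_cases i <;> simp [exampleStructure, Matrix.mulVec, dotProduct, Fin.sum_univ_three] <;> ring
  finrank_eq p := by
    rw [horizontalEigenspace_one_exampleStructure, horizontalEigenspace_neg_one_exampleStructure,
      finrank_span_singleton (fun h => by simpa using congrFun h 1),
      finrank_span_singleton (fun h => by simpa using congrFun h 0)]

theorem isPseudoRiemannianMetric_exampleStructure (hf : ContDiff ℝ ∞ f) :
    IsPseudoRiemannianMetric (exampleStructure f α β γ).g := by
  refine ⟨fun i j => ?_, fun p => ?_, fun p => ?_⟩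
  · have hF := contDiff_exampleF α β γ hf
    fin_cases i <;> fin_cases j <;> simp [exampleStructure] <;> fun_prop
  · ext i j
    fin_cases i <;> fin_cases j <;> simp [exampleStructure]
  · simp [exampleStructure, Matrix.det_fin_three]

theorem dOneForm_exampleStructure (f : ℝ → ℝ) (p : Fin 3 → ℝ) :
    dOneForm (exampleStructure f α β γ).η p
      = !![0, 1 / 4, 0; -1 / 4, 0, 0; 0, 0, 0] := by
  ext i j
  fin_cases i <;> fin_cases j <;> simp [dOneForm, exampleStructure] <;>
    simp (disch := fun_prop) [partialD_mul, partialD_const, partialD_neg, partialD_coord] <;>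
    norm_num

theorem isParacontactRicciSoliton_exampleStructure (hf : ContDiff ℝ ∞ f) :
    IsParacontactRicciSoliton (exampleStructure f α β γ) := by
  refine ⟨⟨isAlmostParacontact_exampleStructure α β γ hf,
    isPseudoRiemannianMetric_exampleStructure α β γ hf, fun p v w => ?_, fun p v w => ?_⟩,
    -2, fun p => ?_⟩
  · simp [exampleStructure, Matrix.mulVec, dotProduct, Fin.sum_univ_three]
    ring
  · rw [dOneForm_exampleStructure]
    simp [exampleStructure, Matrix.mulVec, dotProduct, Fin.sum_univ_three]
    ring
  · rw [ricci_exampleStructure α β γ hf,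
      lieDerivMetric_exampleStructure α β γ (hf.differentiable (by simp))]
    abel

end RicciSoliton

/-! ### Invariance of y under local automorphisms. -/

section LocalAutomorphisms

theorem partialD_eq_of_eqOn {m : ℕ} {U : Set (Fin m → ℝ)} (hU : IsOpen U)
    {u v : (Fin m → ℝ) → ℝ} (h : ∀ q ∈ U, u q = v q) (i : Fin m) {p : Fin m → ℝ} (hp : p ∈ U) :
    partialD i u p = partialD i v p :=
  partialD_congr i (Filter.eventuallyEq_of_mem (hU.mem_nhds hp) h)

theorem partialD_eq_zero_of_eqOn_const {m : ℕ} {U : Set (Fin m → ℝ)} (hU : IsOpen U)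
    {u : (Fin m → ℝ) → ℝ} {c : ℝ} (h : ∀ q ∈ U, u q = c) (i : Fin m) {p : Fin m → ℝ}
    (hp : p ∈ U) : partialD i u p = 0 := by
  rw [partialD_eq_of_eqOn hU h i hp, partialD_const]

/-- The components of a map preserving `η` satisfy the determinant condition coming from `dη`. -/
theorem det_eq_one_of_preserves_η {U : Set (Fin 3 → ℝ)} (hU : IsOpen U)
    {X Y Z : (Fin 3 → ℝ) → ℝ} (hX : ∀ p ∈ U, ContDiffAt ℝ ∞ X p)
    (hY : ∀ p ∈ U, ContDiffAt ℝ ∞ Y p) (hZ : ∀ p ∈ U, ContDiffAt ℝ ∞ Z p)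
    (hη : ∀ p ∈ U, ∀ i, partialD i Z p - Y p * partialD i X p = ![-p 1, 0, 1] i)
    {p : Fin 3 → ℝ} (hp : p ∈ U) :
    partialD 0 X p * partialD 1 Y p - partialD 1 X p * partialD 0 Y p = 1 := by
  have dX (i) : DifferentiableAt ℝ (partialD i X) p := ((hX p hp).partialD i).differentiableAt
    (by simp)
  have dZ (i) : DifferentiableAt ℝ (partialD i Z) p := ((hZ p hp).partialD i).differentiableAt
    (by simp)
  have dY : DifferentiableAt ℝ Y p := (hY p hp).differentiableAt (by simp)
  -- Cross-differentiation, that is, the xy-component of d(dZ - Y dX): the second derivatives of X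
  -- and Z cancel by symmetry.
  have h0 := partialD_eq_of_eqOn hU (fun q hq => hη q hq 0) 1 hp
  have h1 := partialD_eq_of_eqOn hU (fun q hq => hη q hq 1) 0 hp
  rw [partialD_sub _ (dZ _) (dY.fun_mul (dX _)), partialD_mul _ dY (dX _)] at h0 h1
  simp only [Matrix.cons_val, partialD_const, partialD_neg, partialD_coord, if_true] at h0 h1
  rw [partialD_comm 1 0 (hX p hp), partialD_comm 1 0 (hZ p hp)] at h0
  linear_combination h1 - h0

/-- The entries `aᵢ`, `bᵢ` of the first two rows of the Jacobian of a map preserving `η` and `g`: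
the first row vanishes along `∂_y` and `∂_z`, the second along `∂_z`. -/
theorem jacobian_entries_of_preserves {a0 a1 a2 b0 b1 b2 G' : ℝ} (hdet : a0 * b1 - a1 * b0 = 1)
    (h01 : G' * a0 * a1 + a0 * b1 + b0 * a1 = 1) (h11 : G' * a1 * a1 + a1 * b1 + b1 * a1 = 0)
    (h02 : G' * a0 * a2 + a0 * b2 + b0 * a2 = 0) (h12 : G' * a1 * a2 + a1 * b2 + b1 * a2 = 0) :
    a1 = 0 ∧ a2 = 0 ∧ b2 = 0 ∧ a0 * b1 = 1 := by
  -- Adding `hdet` to `h01` gives a0(G' a1 + 2 b1) = 2; times a1, the left side is a0 times that of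
  -- `h11`, hence zero.
  have ha1 : a1 = 0 := by linear_combination (-a1 * h01 - a1 * hdet + a0 * h11) / 2
  have ha2 : a2 = 0 := by linear_combination -a2 * hdet + a0 * h12 - a1 * h02
  subst ha1 ha2
  have hab : a0 * b1 = 1 := by linear_combination hdet
  exact ⟨rfl, rfl, by linear_combination b1 * h02 - b2 * hab, hab⟩

/-- A map `(X, Y, Z)` preserving `η` and `g` preserves the coordinate `y`. -/
theorem snd_eq_of_preserves {f : ℝ → ℝ} (hf : Differentiable ℝ f) {α β γ : ℝ} (hα : α ≠ 0)
    (hβ : β ≠ 0) {U : Set (Fin 3 → ℝ)} (hU : IsOpen U)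
    {X Y Z : (Fin 3 → ℝ) → ℝ} (hX : ∀ p ∈ U, ContDiffAt ℝ ∞ X p)
    (hY : ∀ p ∈ U, ContDiffAt ℝ ∞ Y p) (hZ : ∀ p ∈ U, ContDiffAt ℝ ∞ Z p)
    (hη : ∀ p ∈ U, ∀ i, partialD i Z p - Y p * partialD i X p = ![-p 1, 0, 1] i)
    (hg : ∀ p ∈ U, ∀ i j, (f (X p) + α * Real.exp (2 * Z p) + β * Y p + γ - Y p ^ 2)
        * partialD i X p * partialD j X p + partialD i X p * partialD j Y p
        + partialD i Y p * partialD j X p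
      = !![exampleF f α β γ p - p 1 ^ 2, 1, 0; 1, 0, 0; 0, 0, 0] i j)
    {p : Fin 3 → ℝ} (hp : p ∈ U) : Y p = p 1 := by
  have dX {q} (hq : q ∈ U) : DifferentiableAt ℝ X q := (hX q hq).differentiableAt (by simp)
  have dY {q} (hq : q ∈ U) : DifferentiableAt ℝ Y q := (hY q hq).differentiableAt (by simp)
  have dZ {q} (hq : q ∈ U) : DifferentiableAt ℝ Z q := (hZ q hq).differentiableAt (by simp)
  have dX' {q} (hq : q ∈ U) (i) : DifferentiableAt ℝ (partialD i X) q :=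
    ((hX q hq).partialD i).differentiableAt (by simp)
  have dY' {q} (hq : q ∈ U) (i) : DifferentiableAt ℝ (partialD i Y) q :=
    ((hY q hq).partialD i).differentiableAt (by simp)
  have first (q) (hq : q ∈ U) := jacobian_entries_of_preserves
    (det_eq_one_of_preserves_η hU hX hY hZ hη hq) (by simpa using hg q hq 0 1)
    (by simpa using hg q hq 1 1) (by simpa using hg q hq 0 2) (by simpa using hg q hq 1 2)
  have hZ1 (q) (hq : q ∈ U) : partialD 1 Z q = 0 := by
    simpa [(first q hq).1] using hη q hq 1
  have hZ2 (q) (hq : q ∈ U) : partialD 2 Z q = 1 := by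
    simpa [(first q hq).2.1] using hη q hq 2
  have hX0 (q) (hq : q ∈ U) : partialD 0 X q ≠ 0 := left_ne_zero_of_mul_eq_one (first q hq).2.2.2
  have hX10 (q) (hq : q ∈ U) : partialD 1 (partialD 0 X) q = 0 := by
    rw [partialD_comm 1 0 (hX q hq)]
    exact partialD_eq_zero_of_eqOn_const hU (fun r hr => (first r hr).1) 0 hq
  have hX20 (q) (hq : q ∈ U) : partialD 2 (partialD 0 X) q = 0 := by
    rw [partialD_comm 2 0 (hX q hq)]
    exact partialD_eq_zero_of_eqOn_const hU (fun r hr => (first r hr).2.1) 0 hq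
  have hY20 (q) (hq : q ∈ U) : partialD 2 (partialD 0 Y) q = 0 := by
    rw [partialD_comm 2 0 (hY q hq)]
    exact partialD_eq_zero_of_eqOn_const hU (fun r hr => (first r hr).2.2.1) 0 hq
  have hY01 (q) (hq : q ∈ U) : partialD 0 (partialD 0 X) q * partialD 1 Y q
      + partialD 0 X q * partialD 0 (partialD 1 Y) q = 0 := by
    rw [← partialD_mul _ (dX' hq 0) (dY' hq 1)]
    exact partialD_eq_zero_of_eqOn_const hU (fun r hr => (first r hr).2.2.2) 0 hq
  -- The derivative along ∂ᵢ of the dx² coefficient in `hg`.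
  have dg00 (q) (hq : q ∈ U) (i) :
      (deriv f (X q) * partialD i X q + α * (Real.exp (2 * Z q) * (2 * partialD i Z q))
          + β * partialD i Y q - 2 * Y q * partialD i Y q) * partialD 0 X q ^ 2
        + (f (X q) + α * Real.exp (2 * Z q) + β * Y q + γ - Y q ^ 2)
          * (2 * partialD 0 X q * partialD i (partialD 0 X) q)
        + 2 * (partialD i (partialD 0 X) q * partialD 0 Y q
          + partialD 0 X q * partialD i (partialD 0 Y) q)
      = ![deriv f (q 0), β, 2 * α * Real.exp (2 * q 2)] i
        - (if i = 1 then 2 * q 1 else 0) := by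
    have h := partialD_eq_of_eqOn hU (fun r hr => hg r hr 0 0) i hq
    have d1 := dX hq
    have d2 := dY hq
    have d3 := dZ hq
    have d4 := dX' hq 0
    have d5 := dY' hq 0
    have d6 : DifferentiableAt ℝ (fun r => f (X r)) q := hf.differentiableAt.comp q d1
    have d7 := differentiable_exampleF α β γ hf
    have e6 : partialD i (fun r => f (X r)) q = _ := partialD_comp i hf.differentiableAt d1
    generalize partialD 0 X = a at *
    generalize partialD 0 Y = b at *
    simp (disch := fun_prop) [partialD_mul, partialD_const, partialD_exampleF,
      partialD_coord, partialD_add, partialD_sub, partialD_pow_two, partialD_exp, e6] at h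
    linear_combination h
  -- In the z-derivative only the exponential survives, since X, X_x, Y and Y_x do not depend on z
  -- and Z_z = 1.
  have hexp (q) (hq : q ∈ U) :
      Real.exp (2 * Z q) * partialD 0 X q ^ 2 = Real.exp (2 * q 2) := by
    have h := dg00 q hq 2
    rw [(first q hq).2.1, (first q hq).2.2.1, hZ2 q hq, hX20 q hq, hY20 q hq] at h
    simp at h
    exact mul_left_cancel₀ hα (by linear_combination h / 2)
  -- The x-derivative of `hexp`, whose right side does not involve x.
  have hX00 (q) (hq : q ∈ U) :
      partialD 0 (partialD 0 X) q = -(partialD 0 X q * partialD 0 Z q) := by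
    have h := partialD_eq_of_eqOn hU hexp 0 hq
    have d3 := dZ hq
    have d4 := dX' hq 0
    have ha := hX0 q hq
    generalize partialD 0 X = a at *
    simp (disch := fun_prop) [partialD_mul, partialD_const, partialD_coord,
      partialD_pow_two, partialD_exp] at h
    have he := (Real.exp_pos (2 * Z q)).ne'
    exact mul_left_cancel₀ (mul_ne_zero he ha) (by linear_combination h / 2)
  -- In the y-derivative, X_x Y_xy = Z_x = Y X_x - y, so the terms in Y and y cancel and β X_x = β
  -- remains.
  have hX1 (q) (hq : q ∈ U) : partialD 0 X q = 1 := by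
    have h := dg00 q hq 1
    have h0 := hη q hq 0
    have h01 := hY01 q hq
    have hab := (first q hq).2.2.2
    rw [(first q hq).1, hZ1 q hq, hX10 q hq, partialD_comm 1 0 (hY q hq)] at h
    rw [hX00 q hq] at h01
    simp at h h0
    exact mul_left_cancel₀ hβ (by
      linear_combination h - 2 * h0 - 2 * h01 - (2 * partialD 0 Z q
        + (β - 2 * Y q) * partialD 0 X q) * hab)
  -- X_x = 1 makes X_xx vanish, so Z_x = 0.
  have h00 := hX00 p hp
  have h0 := hη p hp 0
  rw [partialD_eq_zero_of_eqOn_const hU hX1 0 hp, hX1 p hp] at h00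
  rw [hX1 p hp] at h0
  simp at h0
  linarith

theorem IsLocalAutomorphism.snd_eq {f : ℝ → ℝ} (hf : Differentiable ℝ f) {α β γ : ℝ} (hα : α ≠ 0)
    (hβ : β ≠ 0) {ψ : OpenPartialHomeomorph (Fin 3 → ℝ) (Fin 3 → ℝ)}
    (hψ : IsLocalAutomorphism (exampleStructure f α β γ) ψ) {p : Fin 3 → ℝ} (hp : p ∈ ψ.source) :
    ψ p 1 = p 1 := by
  have hs (q) (hq : q ∈ ψ.source) : ContDiffAt ℝ ∞ ψ q :=
    hψ.smooth.contDiffAt (ψ.open_source.mem_nhds hq)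
  have hc (k) (q) (hq : q ∈ ψ.source) : ContDiffAt ℝ ∞ (fun r => ψ r k) q :=
    contDiffAt_pi.1 (hs q hq) k
  have hd (q) (hq : q ∈ ψ.source) (i k) :
      fderiv ℝ ψ q (Pi.single i 1) k = partialD i (fun r => ψ r k) q := by
    rw [partialD, fderiv_apply ((hs q hq).differentiableAt (by simp))]
    rfl
  have hη (q) (hq : q ∈ ψ.source) (i) : partialD i (fun r => ψ r 2) q
      - ψ q 1 * partialD i (fun r => ψ r 0) q = ![-q 1, 0, 1] i := by
    have h := hψ.map_η q hq (Pi.single i 1)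
    simp only [exampleStructure, dotProduct, Fin.sum_univ_three, hd q hq] at h
    fin_cases i <;> simp at h ⊢ <;> linarith
  refine snd_eq_of_preserves hf hα hβ ψ.open_source (hc 0) (hc 1) (hc 2) hη (γ := γ)
    (fun q hq i j => ?_) hp
  have h := hψ.isometry q hq (Pi.single i 1) (Pi.single j 1)
  have hi := hη q hq i
  have hj := hη q hq j
  -- Substituting dZ = Y dX + (dz - y dx) into the isometry condition removes the η⊗η part; the
  -- factor 4 below clears the 1/4 in g.
  rw [sub_eq_iff_eq_add] at hi hj
  simp only [exampleStructure, dotProduct, Matrix.mulVec, Fin.sum_univ_three, hd q hq, hi, hj] at h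
  fin_cases i <;> fin_cases j <;> simp [exampleF] at h ⊢ <;> linear_combination 4 * h

theorem not_isLocallyHomogeneous_exampleStructure {f : ℝ → ℝ} (hf : Differentiable ℝ f)
    {α β : ℝ} (γ : ℝ) (hα : α ≠ 0) (hβ : β ≠ 0) :
    ¬ IsLocallyHomogeneous (exampleStructure f α β γ) := by
  intro h
  -- The points (0,0,0) and (1,1,1) differ in y.
  obtain ⟨ψ, hψ, hp, hq⟩ := h 0 1
  simpa [hq] using hψ.snd_eq hf hα hβ hp

end LocalAutomorphisms

theorem mainTheorem4 (f : ℝ → ℝ) (hf : ContDiff ℝ ∞ f) (α β γ : ℝ) (hα : α ≠ 0) :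
    IsParacontactRicciSoliton (exampleStructure f α β γ) ∧
      (β ≠ 0 → ¬ IsLocallyHomogeneous (exampleStructure f α β γ)) :=
  ⟨isParacontactRicciSoliton_exampleStructure α β γ hf,
    not_isLocallyHomogeneous_exampleStructure (hf.differentiable (by simp)) γ hα⟩
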